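/- Let $n\ge 17$ and $n=n_1+n_0$ with $n_1\ge 1$, let $(M_0,\bar\sigma)$ be a smooth, compact, connected Riemannian manifold of dimension $n_0$ with Laplace–Beltrami operator $\Delta_{\bar\sigma}$ and scalar curvature $R_{\bar\sigma}$, and let $\bar\mu_0<\bar\mu_1\le\bar\mu_2\le\cdots$ be the eigenvalues of $$A=-(n-1)\Delta_{\bar\sigma}-\tfrac{n-2}{2}R_{\bar\sigma}$$ on $M_0$, with smooth eigenfunctions; so $\bar\mu_0$ is the smallest one. Let $l\in\mathbb R$ satisfy $\frac{16(n-1)}{n}\,l^2<238$ and put $$m=\tfrac{(n-1)(n+2)}2,\quad \mu_0=\tfrac{16(n-1)}n\Big(l^2+\tfrac{(n-1)^2n}{12}\Big),\quad m_2=\tfrac{8(n-1)(n-2)}n,\quad \hat\varphi_0(t)=t^{m+2-\frac4n}.$$ (These conditions imply $\mu_0<\frac{(m-1)^2}{4}$.) Let $I=(0,\infty)$, let $\mathcal H_2$ be the closure of $C_c^\infty(I)$ in the norm $$\|u\|_2^2=\int_I\Big(t|u'|^2-\big(\mu_0-\tfrac{(m-1)^2}4\big)t^{-1}|u|^2+m_2t^3|u|^2\Big)dt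 ,$$ and let $\hat{\mathcal H}_2=\{t^{-\frac{m-1}2}u: u\in\mathcal H_2\}$. For $\Lambda<0$ the temporal eigenvalues are the real numbers $\lambda$ for which $$\hat H_0w:=\hat\varphi_0^{-1}\big\{-(t^m w')'-t^{m-2}\mu_0w-t^{m+2}m_2\Lambda w\big\}=\lambda w$$ has a solution $0\ne w\in\hat{\mathcal H}_2$, in the weak sense that $\int_I w\,(\hat H_0v)\,\hat\varphi_0\,dt=\lambda\int_I w\,v\,\hat\varphi_0\,dt$ for all $v\in C_c^\infty(I)$. Let $\lambda_0$ denote the smallest temporal eigenvalue for $\Lambda$, and $\bar\lambda_0$ the smallest temporal eigenvalue for $\Lambda=-1$ (the ground temporal eigenvalues). Suppose that $\bar\mu_0>0$ and define $\Lambda_0<0$ by $$|\Lambda_0|^{\frac{n-1}n}=\bar\lambda_0^{-1}\,\frac{16(n-1)}n\,\bar\mu_0 .$$ Then, for every $\Lambda<0$ with $|\Lambda|\ge|\Lambda_0|$, $$\lambda_0\ \ge\ \frac{16(n-1)}n\,\bar\mu_0 .$$ Hence, for such $\Lambda$, every temporal eigenvalue can be matched by a spatial eigenvalue: for every temporal eigenvalue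 $\lambda$ there are $\xi\in\mathbb R^{n_1}$ and an eigenvalue $\bar\mu_k$ of $A$ such that $$\lambda=\frac{16(n-1)}n\big\{(n-1)|\xi|^2+\bar\mu_k\big\}.$$ -/

import Mathlib

open Set MeasureTheory
open scoped Manifold ContDiff

namespace QuantumGravity

noncomputable section

/-! ### Riemannian geometry in coordinates -/

section Coordinates

variable {d : ℕ}

/-- The partial derivative `∂ᵢ f` at the point `y` of `ℝ^d`. -/
def pd (i : Fin d) (f : EuclideanSpace ℝ (Fin d) → ℝ) (y : EuclideanSpace ℝ (Fin d)) : ℝ :=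
  fderiv ℝ f y (EuclideanSpace.single i 1)

/-- The Christoffel symbol `Γ^k_{ij}` of a coordinate metric `G = (g_{ij})`. -/
def christoffel (G : EuclideanSpace ℝ (Fin d) → Matrix (Fin d) (Fin d) ℝ) (k i j : Fin d)
    (y : EuclideanSpace ℝ (Fin d)) : ℝ :=
  (1 / 2) * ∑ l, (G y)⁻¹ k l *
    (pd i (fun z => G z j l) y + pd j (fun z => G z i l) y - pd l (fun z => G z i j) y)

/-- The coordinate expression of the Laplace–Beltrami operator,
`Δ f = g^{ij} (∂ᵢ∂ⱼ f - Γ^k_{ij} ∂ₖ f)`. -/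
def coordLaplacian (G : EuclideanSpace ℝ (Fin d) → Matrix (Fin d) (Fin d) ℝ)
    (f : EuclideanSpace ℝ (Fin d) → ℝ) (y : EuclideanSpace ℝ (Fin d)) : ℝ :=
  ∑ i, ∑ j, (G y)⁻¹ i j * (pd i (pd j f) y - ∑ k, christoffel G k i j y * pd k f y)

/-- The coordinate expression of the Ricci tensor, with the sign for which round spheres have
positive Ricci curvature:
`R_{ij} = ∂ₖ Γ^k_{ij} - ∂ⱼ Γ^k_{ki} + Γ^k_{kl} Γ^l_{ij} - Γ^k_{jl} Γ^l_{ki}`. -/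
def coordRicci (G : EuclideanSpace ℝ (Fin d) → Matrix (Fin d) (Fin d) ℝ) (i j : Fin d)
    (y : EuclideanSpace ℝ (Fin d)) : ℝ :=
  ∑ k, (pd k (christoffel G k i j) y - pd j (christoffel G k k i) y
    + ∑ l, (christoffel G k k l y * christoffel G l i j y
      - christoffel G k j l y * christoffel G l k i y))

/-- The coordinate expression of the scalar curvature, `R = g^{ij} R_{ij}`. -/
def coordScalarCurvature (G : EuclideanSpace ℝ (Fin d) → Matrix (Fin d) (Fin d) ℝ)
    (y : EuclideanSpace ℝ (Fin d)) : ℝ :=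
  ∑ i, ∑ j, (G y)⁻¹ i j * coordRicci G i j y

end Coordinates

/-! ### The spatial operator on the compact factor -/

section Spatial

variable {d : ℕ} {M : Type*} [TopologicalSpace M] [ChartedSpace (EuclideanSpace ℝ (Fin d)) M]
  [IsManifold (𝓡 d) ∞ M]

/-- A smooth Riemannian metric on the `d`-dimensional smooth manifold `M`. -/
abbrev SmoothMetric (d : ℕ) (M : Type*) [TopologicalSpace M]
    [ChartedSpace (EuclideanSpace ℝ (Fin d)) M] [IsManifold (𝓡 d) ∞ M] :=
  Bundle.ContMDiffRiemannianMetric (𝓡 d) ∞ (EuclideanSpace ℝ (Fin d))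
    (fun x : M => TangentSpace (𝓡 d) x)

/-- The coefficients `g_{ij} = g(∂ᵢ, ∂ⱼ)` of the metric `g` in the preferred chart at `x`. -/
def metricCoeff (g : SmoothMetric d M) (x : M) (y : EuclideanSpace ℝ (Fin d)) :
    Matrix (Fin d) (Fin d) ℝ :=
  Matrix.of fun i j =>
    g.inner ((extChartAt (𝓡 d) x).symm y)
      (mfderiv 𝓘(ℝ, EuclideanSpace ℝ (Fin d)) (𝓡 d) (extChartAt (𝓡 d) x).symm y
        (EuclideanSpace.single i (1 : ℝ) : EuclideanSpace ℝ (Fin d)))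
      (mfderiv 𝓘(ℝ, EuclideanSpace ℝ (Fin d)) (𝓡 d) (extChartAt (𝓡 d) x).symm y
        (EuclideanSpace.single j (1 : ℝ) : EuclideanSpace ℝ (Fin d)))

/-- The Laplace–Beltrami operator of `(M, g)`; its value at `x` is computed in the preferred
chart at `x`. -/
def laplaceBeltrami (g : SmoothMetric d M) (f : M → ℝ) (x : M) : ℝ :=
  coordLaplacian (metricCoeff g x) (fun y => f ((extChartAt (𝓡 d) x).symm y))
    (extChartAt (𝓡 d) x x)

/-- The scalar curvature of `(M, g)`. -/
def scalarCurvature (g : SmoothMetric d M) (x : M) : ℝ :=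
  coordScalarCurvature (metricCoeff g x) (extChartAt (𝓡 d) x x)

/-- The operator `A = -(n-1) Δ - (n-2)/2 R` on `(M, g)`. The number `n` is the dimension of the
full product `ℝ^{n₁} × M`, not that of `M`. -/
def spatialOperator (n : ℕ) (g : SmoothMetric d M) (f : M → ℝ) (x : M) : ℝ :=
  -((n : ℝ) - 1) * laplaceBeltrami g f x - ((n : ℝ) - 2) / 2 * scalarCurvature g x * f x

/-- The eigenvalues of `A`, with smooth eigenfunctions. -/
def spatialEigenvalues (n : ℕ) (g : SmoothMetric d M) : Set ℝ :=
  {μ | ∃ f : M → ℝ, ContMDiff (𝓡 d) 𝓘(ℝ, ℝ) ∞ f ∧ f ≠ 0 ∧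
    ∀ x, spatialOperator n g f x = μ * f x}

end Spatial

/-! ### The temporal operator on the half line `I = (0, ∞)` -/

section Temporal

/-- `m = (n-1)(n+2)/2`. -/
def mExp (n : ℕ) : ℝ := ((n : ℝ) - 1) * ((n : ℝ) + 2) / 2

/-- `|ρ|² = (n-1)² n / 12`. -/
def rhoSq (n : ℕ) : ℝ := ((n : ℝ) - 1) ^ 2 * (n : ℝ) / 12

/-- `μ₀ = 16(n-1)/n (l² + |ρ|²)`; here `l` is the spectral parameter on `SL(n,ℝ)/SO(n)`. -/
def muZero (n : ℕ) (l : ℝ) : ℝ := 16 * ((n : ℝ) - 1) / n * (l ^ 2 + rhoSq n)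

/-- `m₂ = 8(n-1)(n-2)/n`. -/
def mTwo (n : ℕ) : ℝ := 8 * ((n : ℝ) - 1) * ((n : ℝ) - 2) / n

/-- The Bessel constant `μ₀ - (m-1)²/4`. -/
def besselConst (n : ℕ) (l : ℝ) : ℝ := muZero n l - (mExp n - 1) ^ 2 / 4

/-- Test functions on `I`: smooth, with compact support contained in `(0, ∞)`. -/
def IsTestFunction (v : ℝ → ℝ) : Prop :=
  ContDiff ℝ ∞ v ∧ HasCompactSupport v ∧ tsupport v ⊆ Ioi 0

/-- The squared norm
`‖u‖₂² = ∫_I (t |u'|² - (μ₀ - (m-1)²/4) t⁻¹ |u|² + m₂ t³ |u|²) dt`,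
as a function of `u` and its derivative `du`. -/
def normTwoSq (n : ℕ) (l : ℝ) (u du : ℝ → ℝ) : ENNReal :=
  ∫⁻ t in Ioi (0 : ℝ), ENNReal.ofReal
    (t * du t ^ 2 - besselConst n l * t⁻¹ * u t ^ 2 + mTwo n * t ^ 3 * u t ^ 2)

/-- The space `𝓗₂`, the closure of the test functions in the norm `‖·‖₂`: `u` belongs to it if
there is a function `du` (then the weak derivative of `u`) such that test functions come
arbitrarily close to `u`, together with their derivatives to `du`. -/
def MemHTwo (n : ℕ) (l : ℝ) (u : ℝ → ℝ) : Prop :=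
  AEStronglyMeasurable u (volume.restrict (Ioi 0)) ∧
  ∃ du : ℝ → ℝ, AEStronglyMeasurable du (volume.restrict (Ioi 0)) ∧
    ∀ ε : ENNReal, 0 < ε → ∃ v : ℝ → ℝ, IsTestFunction v ∧
      normTwoSq n l (fun t => u t - v t) (fun t => du t - deriv v t) < ε

/-- The space of all `w = t^{-(m-1)/2} u` with `u` in `𝓗₂`. -/
def MemHatHTwo (n : ℕ) (l : ℝ) (w : ℝ → ℝ) : Prop :=
  MemHTwo n l (fun t => t ^ ((mExp n - 1) / 2) * w t)

/-- The weight `φ̂₀(t) = t^{m + 2 - 4/n}`. -/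
def hatPhi (n : ℕ) (t : ℝ) : ℝ := t ^ (mExp n + 2 - 4 / (n : ℝ))

/-- The differential operator
`Ĥ₀ v = φ̂₀⁻¹ { -(t^m v')' - t^{m-2} μ₀ v - t^{m+2} m₂ Λ v }`. -/
def hatH (n : ℕ) (l Λ : ℝ) (v : ℝ → ℝ) (t : ℝ) : ℝ :=
  (hatPhi n t)⁻¹ *
    (-deriv (fun s => s ^ mExp n * deriv v s) t - t ^ (mExp n - 2) * muZero n l * v t
      - t ^ (mExp n + 2) * mTwo n * Λ * v t)

/-- The temporal eigenvalues: the real numbers `c` for which `Ĥ₀ w = c w` has a solution `w`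
which is not almost everywhere zero and lies in the form domain. The equation is understood
weakly in the Hilbert space `L²(I, φ̂₀ dt)`, i.e. `⟨w, Ĥ₀ v⟩ = c ⟨w, v⟩` for all test
functions `v`. -/
def temporalEigenvalues (n : ℕ) (l Λ : ℝ) : Set ℝ :=
  {c | ∃ w : ℝ → ℝ, MemHatHTwo n l w ∧ (¬ w =ᵐ[volume.restrict (Ioi 0)] 0) ∧
    ∀ v : ℝ → ℝ, IsTestFunction v →
      ∫ t in Ioi (0 : ℝ), w t * hatH n l Λ v t * hatPhi n t
        = c * ∫ t in Ioi (0 : ℝ), w t * v t * hatPhi n t}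

end Temporal

end

end QuantumGravity

namespace QuantumGravity

/-! Under `t ↦ c t` every term of `Ĥ₀` acquires the same power of `c` once `Λ` is replaced by `c⁴
Λ`, so eigenvalues are multiplied by `c ^ (4 - 4/n)` (`hatH_comp_mul_left`). The form domain is
dilation invariant, because the nonpositive Bessel constant makes each term of the norm nonnegative
(`MemHTwo.dilation`). With `c = |Λ|^(1/4)`, the spectrum for `Λ` is `|Λ|^((n-1)/n)` times that for
`-1` (`temporalEigenvalues_eq_image`). The lower bound is then monotonicity in `|Λ|`, and the gap to
`μbar₀` is filled by `|ξ|²`, which takes every nonnegative value since `n₁ ≥ 1`. -/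

theorem map_mul_left_volume_restrict_Ioi {c : ℝ} (hc : 0 < c) :
    Measure.map (fun t => c * t) (volume.restrict (Ioi (0 : ℝ)))
      = ENNReal.ofReal c⁻¹ • volume.restrict (Ioi (0 : ℝ)) := by
  have he : MeasurableEmbedding (fun t : ℝ => c * t) := measurableEmbedding_mulLeft₀ hc.ne'
  have hpre : (fun t : ℝ => c * t) ⁻¹' Ioi 0 = Ioi 0 := by
    ext t
    simp [hc]
  have h := he.restrict_map (volume : Measure ℝ) (Ioi 0)
  rw [hpre, Real.map_volume_mul_left hc.ne', Measure.restrict_smul, abs_of_pos (inv_pos.2 hc)] at h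
  exact h.symm

theorem quasiMeasurePreserving_mul_left_Ioi {c : ℝ} (hc : 0 < c) :
    Measure.QuasiMeasurePreserving (fun t => c * t) (volume.restrict (Ioi (0 : ℝ)))
      (volume.restrict (Ioi (0 : ℝ))) := by
  refine ⟨measurable_const_mul c, ?_⟩
  rw [map_mul_left_volume_restrict_Ioi hc]
  exact Measure.smul_absolutelyContinuous

theorem lintegral_comp_mul_left_Ioi {c : ℝ} (hc : 0 < c) (F : ℝ → ENNReal) :
    ∫⁻ t in Ioi (0 : ℝ), F (c * t) = ENNReal.ofReal c⁻¹ * ∫⁻ t in Ioi (0 : ℝ), F t := by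
  rw [← (measurableEmbedding_mulLeft₀ hc.ne').lintegral_map F,
    map_mul_left_volume_restrict_Ioi hc, lintegral_smul_measure, smul_eq_mul]

theorem IsTestFunction.comp_mul_left {v : ℝ → ℝ} (hv : IsTestFunction v) {c : ℝ} (hc : 0 < c) :
    IsTestFunction (fun t => v (c * t)) := by
  obtain ⟨h1, h2, h3⟩ := hv
  refine ⟨h1.comp (contDiff_const.mul contDiff_id),
    h2.comp_homeomorph (Homeomorph.mulLeft₀ c hc.ne'), ?_⟩
  intro t ht
  have h : c * t ∈ tsupport v :=
    tsupport_comp_subset_preimage v (continuous_const_mul c) ht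
  exact pos_of_mul_pos_right (h3 h) hc.le

theorem IsTestFunction.const_mul {v : ℝ → ℝ} (hv : IsTestFunction v) (b : ℝ) :
    IsTestFunction (fun t => b * v t) := by
  obtain ⟨h1, h2, h3⟩ := hv
  exact ⟨contDiff_const.mul h1, h2.mul_left, (tsupport_mul_subset_right).trans h3⟩

/-! ### Dilation invariance of the form domain -/

theorem besselConst_nonpos {n : ℕ} (hn : 17 ≤ n) {l : ℝ}
    (hl : 16 * ((n : ℝ) - 1) / n * l ^ 2 < 238) : besselConst n l ≤ 0 := by
  obtain ⟨k, rfl⟩ := Nat.exists_eq_add_of_le hn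
  have hk : (0 : ℝ) ≤ k := k.cast_nonneg
  unfold besselConst muZero mExp rhoSq
  push_cast at hl ⊢
  have hpos : (17 : ℝ) + k ≠ 0 := by positivity
  have e : 16 * ((17 : ℝ) + k - 1) / (17 + k) * (l ^ 2 + (17 + k - 1) ^ 2 * (17 + k) / 12)
      = 16 * ((17 : ℝ) + k - 1) / (17 + k) * l ^ 2 + 4 / 3 * (16 + k) ^ 3 := by
    field_simp
    ring
  rw [e]
  -- As a polynomial in `k` this has only nonnegative coefficients. Its constant term is `5700.25 -
  -- 238 - 16384/3 > 0`, which is where `238` and `17` enter.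
  have h : 0 ≤ (((17 : ℝ) + k - 1) * (17 + k + 2) / 2 - 1) ^ 2 / 4
      - (238 + 4 / 3 * (16 + k) ^ 3) := by
    ring_nf
    positivity
  linarith

theorem mTwo_nonneg {n : ℕ} (hn : 2 ≤ n) : 0 ≤ mTwo n := by
  have : (2 : ℝ) ≤ n := by exact_mod_cast hn
  unfold mTwo
  exact div_nonneg (mul_nonneg (by linarith) (by linarith)) (by linarith)

/-- The derivative and Bessel terms scale exactly by `b²`, the `t³` term by `b² c⁻⁴`. Since all
three are nonnegative, the larger factor bounds the sum. -/
theorem normTwoSq_dilation_le {n : ℕ} {l : ℝ} (hn : 2 ≤ n) (hB : besselConst n l ≤ 0)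
    {c : ℝ} (hc : 0 < c) (b : ℝ) {u du u' du' : ℝ → ℝ}
    (hu : ∀ t, 0 < t → u' t = b * u (c * t)) (hdu : ∀ t, 0 < t → du' t = b * c * du (c * t)) :
    normTwoSq n l u' du' ≤ ENNReal.ofReal (b ^ 2 * max 1 (c⁻¹ ^ 4)) * normTwoSq n l u du := by
  set K := max 1 (c⁻¹ ^ 4) with hK
  have hK0 : 0 < K := lt_of_lt_of_le one_pos (le_max_left _ _)
  have key : normTwoSq n l u' du' ≤ ∫⁻ t in Ioi (0 : ℝ), (ENNReal.ofReal (b ^ 2 * K * c) *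
      (fun s => ENNReal.ofReal (s * du s ^ 2 - besselConst n l * s⁻¹ * u s ^ 2
        + mTwo n * s ^ 3 * u s ^ 2)) (c * t)) := by
    refine setLIntegral_mono' measurableSet_Ioi fun t ht => ?_
    have ht : 0 < t := ht
    simp only
    rw [← ENNReal.ofReal_mul (by positivity), hu t ht, hdu t ht]
    refine ENNReal.ofReal_le_ofReal ?_
    have hm := mTwo_nonneg hn
    have e1 : 0 ≤ t * c ^ 2 * (b * du (c * t)) ^ 2 := by positivity
    have e2 : 0 ≤ -besselConst n l * t⁻¹ * (b * u (c * t)) ^ 2 :=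
      mul_nonneg (mul_nonneg (by linarith) (by positivity)) (sq_nonneg _)
    have e3 : 0 ≤ mTwo n * t ^ 3 * (b * u (c * t)) ^ 2 := by positivity
    have k1 : 1 ≤ K := le_max_left _ _
    have k2 : 1 ≤ K * c ^ 4 := by
      calc (1 : ℝ) = c⁻¹ ^ 4 * c ^ 4 := by field_simp
        _ ≤ K * c ^ 4 := by gcongr; exact le_max_right _ _
    have f1 := mul_le_mul_of_nonneg_right k1 e1
    have f2 := mul_le_mul_of_nonneg_right k1 e2
    have f3 := mul_le_mul_of_nonneg_right k2 e3
    have e : b ^ 2 * K * c * (c * t * du (c * t) ^ 2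
          - besselConst n l * (c * t)⁻¹ * u (c * t) ^ 2 + mTwo n * (c * t) ^ 3 * u (c * t) ^ 2)
        = K * (t * c ^ 2 * (b * du (c * t)) ^ 2)
          + K * (-besselConst n l * t⁻¹ * (b * u (c * t)) ^ 2)
          + K * c ^ 4 * (mTwo n * t ^ 3 * (b * u (c * t)) ^ 2) := by
      field_simp
      ring
    rw [e]
    linarith
  refine key.trans (le_of_eq ?_)
  rw [lintegral_const_mul' _ _ ENNReal.ofReal_ne_top, lintegral_comp_mul_left_Ioi hc
    (fun s => ENNReal.ofReal (s * du s ^ 2 - besselConst n l * s⁻¹ * u s ^ 2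
      + mTwo n * s ^ 3 * u s ^ 2)), ← mul_assoc,
    ← ENNReal.ofReal_mul (by positivity)]
  congr 2
  field_simp

theorem MemHTwo.dilation {n : ℕ} {l : ℝ} (hn : 2 ≤ n) (hB : besselConst n l ≤ 0)
    {c b : ℝ} (hc : 0 < c) (hb : b ≠ 0) {u u' : ℝ → ℝ}
    (hu : ∀ t, 0 < t → u' t = b * u (c * t)) (h : MemHTwo n l u) : MemHTwo n l u' := by
  obtain ⟨hm, du, hdm, happ⟩ := h
  have hq := quasiMeasurePreserving_mul_left_Ioi hc
  refine ⟨?_, fun t => b * c * du (c * t),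
    (hdm.comp_quasiMeasurePreserving hq).const_mul _, fun ε hε => ?_⟩
  · refine ((hm.comp_quasiMeasurePreserving hq).const_mul b).congr ?_
    filter_upwards [ae_restrict_mem measurableSet_Ioi] with t ht
    exact (hu t ht).symm
  · set K := b ^ 2 * max 1 (c⁻¹ ^ 4) with hKdef
    have hK : 0 < K :=
      mul_pos (by positivity) (lt_of_lt_of_le one_pos (le_max_left _ _))
    obtain ⟨v, hv, hlt⟩ := happ (ε / ENNReal.ofReal K)
      (ENNReal.div_pos hε.ne' ENNReal.ofReal_ne_top)
    refine ⟨fun t => b * v (c * t), (hv.comp_mul_left hc).const_mul b, ?_⟩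
    refine (normTwoSq_dilation_le hn hB hc b (fun t ht => ?_) (fun t ht => ?_)).trans_lt
      (ENNReal.mul_lt_of_lt_div' hlt)
    · simp only [hu t ht]
      ring
    · have : deriv (fun t => b * v (c * t)) t = b * (c * deriv v (c * t)) := by
        rw [deriv_const_mul_field, deriv_comp_mul_left c v t, smul_eq_mul]
      simp only [this]
      ring

theorem MemHatHTwo.dilation {n : ℕ} {l : ℝ} (hn : 2 ≤ n) (hB : besselConst n l ≤ 0)
    {c : ℝ} (hc : 0 < c) {w : ℝ → ℝ} (h : MemHatHTwo n l w) :
    MemHatHTwo n l (fun t => w (c * t)) := by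
  refine MemHTwo.dilation hn hB hc (b := (c ^ ((mExp n - 1) / 2))⁻¹)
    (inv_ne_zero (Real.rpow_pos_of_pos hc _).ne') (fun t ht => ?_) h
  have := (Real.rpow_pos_of_pos hc ((mExp n - 1) / 2)).ne'
  simp only
  rw [Real.mul_rpow hc.le ht.le]
  field_simp

/-! ### Scaling of the operator and of its spectrum -/

theorem hatPhi_mul {n : ℕ} {c t : ℝ} (hc : 0 < c) (ht : 0 < t) :
    hatPhi n (c * t) = hatPhi n c * hatPhi n t :=
  Real.mul_rpow hc.le ht.le

/-- The braces scale by `c ^ (2 - m)`, where `c⁴` compensates the two extra powers on each side of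
`t^m`; the weight contributes `c ^ (m + 2 - 4/n)`. -/
theorem hatH_comp_mul_left {n : ℕ} {l Λ c t : ℝ} (hc : 0 < c) (ht : 0 < t) (v : ℝ → ℝ) :
    hatH n l (c ^ 4 * Λ) (fun s => v (c * s)) t
      = c ^ (4 - 4 / (n : ℝ)) * hatH n l Λ v (c * t) := by
  have hd : deriv (fun s => s ^ mExp n * deriv (fun s => v (c * s)) s) t
      = c ^ (2 - mExp n) * deriv (fun s => s ^ mExp n * deriv v s) (c * t) := by
    have h1 : (fun s => s ^ mExp n * deriv (fun s => v (c * s)) s) =ᶠ[nhds t]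
        fun s => c ^ (1 - mExp n) * (fun r => r ^ mExp n * deriv v r) (c * s) := by
      filter_upwards [Ioi_mem_nhds ht] with s hs
      have hs : 0 < s := hs
      have := (Real.rpow_pos_of_pos hc (mExp n)).ne'
      rw [deriv_comp_mul_left c v s, smul_eq_mul, Real.mul_rpow hc.le hs.le,
        Real.rpow_sub hc, Real.rpow_one]
      field_simp
    rw [h1.deriv_eq, deriv_const_mul_field, deriv_comp_mul_left c (fun r => r ^ mExp n * deriv v r) t, smul_eq_mul, ← mul_assoc]
    congr 1
    rw [← Real.rpow_add_one hc.ne']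
    congr 1
    ring
  unfold hatH
  rw [hd, hatPhi_mul hc ht, Real.mul_rpow hc.le ht.le, Real.mul_rpow hc.le ht.le]
  unfold hatPhi
  have hA := (Real.rpow_pos_of_pos hc (mExp n)).ne'
  have hq := (Real.rpow_pos_of_pos hc (4 / (n : ℝ))).ne'
  have hT := (Real.rpow_pos_of_pos ht (mExp n + 2 - 4 / (n : ℝ))).ne'
  have e2 : c ^ (2 : ℝ) = c ^ 2 := by exact_mod_cast Real.rpow_natCast c 2
  have e4 : c ^ (4 : ℝ) = c ^ 4 := by exact_mod_cast Real.rpow_natCast c 4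
  rw [Real.rpow_sub hc, Real.rpow_sub hc, Real.rpow_sub hc, Real.rpow_sub hc, Real.rpow_add hc,
    e2, e4]
  field_simp

theorem temporalEigenvalues_dilation {n : ℕ} {l Λ c : ℝ} (hn : 2 ≤ n)
    (hB : besselConst n l ≤ 0) (hc : 0 < c) {lam : ℝ} (h : lam ∈ temporalEigenvalues n l Λ) :
    c ^ (4 - 4 / (n : ℝ)) * lam ∈ temporalEigenvalues n l (c ^ 4 * Λ) := by
  obtain ⟨w, hw, hw0, heq⟩ := h
  refine ⟨fun t => w (c * t), hw.dilation hn hB hc, fun h0 => hw0 ?_, fun v hv => ?_⟩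
  · have h1 := (quasiMeasurePreserving_mul_left_Ioi (inv_pos.2 hc)).ae h0
    filter_upwards [h1] with t ht
    simpa [mul_inv_cancel_left₀ hc.ne'] using ht
  -- Every test function is the dilate of another, so the weak equation for `w` can be used after
  -- the substitution `s = c t`.
  · obtain ⟨v', hv', rfl⟩ : ∃ v', IsTestFunction v' ∧ v = fun s => v' (c * s) :=
      ⟨fun s => v (c⁻¹ * s), hv.comp_mul_left (inv_pos.2 hc), by
        ext s
        simp [inv_mul_cancel_left₀ hc.ne']⟩
    have hP : hatPhi n c ≠ 0 := (Real.rpow_pos_of_pos hc _).ne'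
    have h1 : ∫ t in Ioi (0 : ℝ), w (c * t) * hatH n l (c ^ 4 * Λ) (fun s => v' (c * s)) t
          * hatPhi n t
        = c ^ (4 - 4 / (n : ℝ)) * (hatPhi n c)⁻¹ *
          ∫ t in Ioi (0 : ℝ), (fun s => w s * hatH n l Λ v' s * hatPhi n s) (c * t) := by
      rw [← integral_const_mul]
      refine setIntegral_congr_fun measurableSet_Ioi fun t ht => ?_
      simp only
      rw [hatH_comp_mul_left hc ht, hatPhi_mul hc ht]
      field_simp
    have h2 : ∫ t in Ioi (0 : ℝ), w (c * t) * v' (c * t) * hatPhi n t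
        = (hatPhi n c)⁻¹ *
          ∫ t in Ioi (0 : ℝ), (fun s => w s * v' s * hatPhi n s) (c * t) := by
      rw [← integral_const_mul]
      refine setIntegral_congr_fun measurableSet_Ioi fun t ht => ?_
      simp only
      rw [hatPhi_mul hc ht]
      field_simp
    rw [h1, h2, integral_comp_mul_left_Ioi (fun s => w s * hatH n l Λ v' s * hatPhi n s) 0 hc,
      integral_comp_mul_left_Ioi (fun s => w s * v' s * hatPhi n s) 0 hc, mul_zero,
      heq v' hv', smul_eq_mul, smul_eq_mul]
    ring

/-- One inclusion is dilation by `c = |Λ|^(1/4)`, the other dilation by `c⁻¹`. -/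
theorem temporalEigenvalues_eq_image {n : ℕ} {l Λ : ℝ} (hn : 2 ≤ n)
    (hB : besselConst n l ≤ 0) (hΛ : Λ < 0) :
    temporalEigenvalues n l Λ
      = (fun lam => |Λ| ^ (((n : ℝ) - 1) / n) * lam) '' temporalEigenvalues n l (-1) := by
  have hΛ' : 0 < |Λ| := abs_pos.2 hΛ.ne
  have hn0 : (n : ℝ) ≠ 0 := by positivity
  set c := |Λ| ^ (1 / 4 : ℝ) with hc
  have hc0 : 0 < c := Real.rpow_pos_of_pos hΛ' _
  have hc4 : c ^ 4 = -Λ := by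
    rw [hc, ← Real.rpow_natCast, ← Real.rpow_mul hΛ'.le, ← abs_of_neg hΛ]
    norm_num
  have he : c ^ (4 - 4 / (n : ℝ)) = |Λ| ^ (((n : ℝ) - 1) / n) := by
    rw [hc, ← Real.rpow_mul hΛ'.le]
    congr 1
    field_simp
  rw [← he]
  ext lam
  constructor
  · intro h
    refine ⟨c⁻¹ ^ (4 - 4 / (n : ℝ)) * lam, ?_, ?_⟩
    · have h1 := temporalEigenvalues_dilation hn hB (inv_pos.2 hc0) h
      have e : c⁻¹ ^ 4 * Λ = -1 := by
        rw [inv_pow, hc4]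
        field_simp [hΛ.ne]
      rwa [e] at h1
    · simp only
      rw [Real.inv_rpow hc0.le, mul_inv_cancel_left₀ (Real.rpow_pos_of_pos hc0 _).ne']
  · rintro ⟨lam', h, rfl⟩
    have h1 := temporalEigenvalues_dilation hn hB hc0 h
    rwa [hc4, mul_neg_one, neg_neg] at h1

end QuantumGravity

/-! ### Comparison with the spatial eigenvalues -/

theorem corollary5p16
    (n n₁ n₀ : ℕ) (hn : 17 ≤ n) (hn₁ : 1 ≤ n₁) (hdim : n₁ + n₀ = n)
    {M₀ : Type*} [TopologicalSpace M₀] [T2Space M₀] [CompactSpace M₀] [ConnectedSpace M₀]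
    [ChartedSpace (EuclideanSpace ℝ (Fin n₀)) M₀] [IsManifold (𝓡 n₀) ∞ M₀]
    (σ : QuantumGravity.SmoothMetric n₀ M₀)
    (l : ℝ) (hl : 16 * ((n : ℝ) - 1) / n * l ^ 2 < 238)
    (μbar₀ : ℝ) (hμbar₀ : IsLeast (QuantumGravity.spatialEigenvalues n σ) μbar₀)
    (hμpos : 0 < μbar₀)
    (lamBar₀ : ℝ) (hlamBar₀ : IsLeast (QuantumGravity.temporalEigenvalues n l (-1)) lamBar₀)
    (Λ₀ : ℝ) (hΛ₀neg : Λ₀ < 0)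
    (hΛ₀ : |Λ₀| ^ (((n : ℝ) - 1) / n) = lamBar₀⁻¹ * (16 * ((n : ℝ) - 1) / n) * μbar₀)
    (Λ : ℝ) (hΛneg : Λ < 0) (hΛ : |Λ₀| ≤ |Λ|) :
    (∃ lam₀ : ℝ, IsLeast (QuantumGravity.temporalEigenvalues n l Λ) lam₀ ∧
      16 * ((n : ℝ) - 1) / n * μbar₀ ≤ lam₀) ∧
    (∀ lam ∈ QuantumGravity.temporalEigenvalues n l Λ,
      ∃ ξ : EuclideanSpace ℝ (Fin n₁), ∃ μ ∈ QuantumGravity.spatialEigenvalues n σ,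
        lam = 16 * ((n : ℝ) - 1) / n * (((n : ℝ) - 1) * ‖ξ‖ ^ 2 + μ)) := by
  have hB := QuantumGravity.besselConst_nonpos hn hl
  have hn17 : (17 : ℝ) ≤ n := by exact_mod_cast hn
  have hκ : 0 < 16 * ((n : ℝ) - 1) / n := div_pos (by linarith) (by linarith)
  have hpow : 0 < |Λ₀| ^ (((n : ℝ) - 1) / n) := Real.rpow_pos_of_pos (abs_pos.2 hΛ₀neg.ne) _
  -- Positivity needs no spectral theory: the equation defining `Λ₀` has a positive left side, and
  -- `μbar₀ > 0`.
  have hlam : 0 < lamBar₀ := by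
    rw [hΛ₀, mul_assoc] at hpow
    exact inv_pos.1 (pos_of_mul_pos_left hpow (mul_pos hκ hμpos).le)
  have hμ : 16 * ((n : ℝ) - 1) / n * μbar₀ = |Λ₀| ^ (((n : ℝ) - 1) / n) * lamBar₀ := by
    rw [hΛ₀]
    field_simp
  have hle : 16 * ((n : ℝ) - 1) / n * μbar₀ ≤ |Λ| ^ (((n : ℝ) - 1) / n) * lamBar₀ := by
    rw [hμ]
    exact mul_le_mul_of_nonneg_right (Real.rpow_le_rpow (abs_nonneg _) hΛ
      (div_nonneg (by linarith) (by linarith))) hlam.le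
  have hleast : IsLeast (QuantumGravity.temporalEigenvalues n l Λ)
      (|Λ| ^ (((n : ℝ) - 1) / n) * lamBar₀) := by
    rw [QuantumGravity.temporalEigenvalues_eq_image (by lia) hB hΛneg]
    exact Monotone.map_isLeast
      (fun a b hab => mul_le_mul_of_nonneg_left hab (by positivity)) hlamBar₀
  refine ⟨⟨_, hleast, hle⟩, fun lam hlam' => ?_⟩
  have hge := hle.trans (hleast.2 hlam')
  set κ := 16 * ((n : ℝ) - 1) / n
  have hn1 : (0 : ℝ) < n - 1 := by linarith
  have hr : 0 ≤ (lam / κ - μbar₀) / ((n : ℝ) - 1) :=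
    div_nonneg (sub_nonneg.2 ((le_div_iff₀' hκ).2 hge)) hn1.le
  -- The lowest spatial eigenvalue serves for every `lam`; `ξ` points along the first axis with the
  -- length that makes up the difference.
  refine ⟨EuclideanSpace.single ⟨0, hn₁⟩ √((lam / κ - μbar₀) / ((n : ℝ) - 1)), μbar₀,
    hμbar₀.1, ?_⟩
  rw [show ‖EuclideanSpace.single (⟨0, hn₁⟩ : Fin n₁)
      √((lam / κ - μbar₀) / ((n : ℝ) - 1))‖ = _ from PiLp.norm_single 2 (fun _ : Fin n₁ => ℝ) _ _, Real.norm_eq_abs, sq_abs, Real.sq_sqrt hr]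
  field_simp
  ring
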